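/- Let $0<\alpha<1$, $L_0>0$, $T>0$, and for $t\ge 0$ put \[ I_0=\frac{1}{\Gamma(1-\alpha)}\int_0^{L_0}x^{-\alpha}e^{-tx}\,dx,\qquad f_0(x)=\frac{1}{\Gamma(1-\alpha)}\Big(\frac{L_0}{2}\Big)^{1-\alpha}e^{-t(x+1)L_0/2},\qquad w(x)=(1+x)^{-\alpha}. \] For an integer $Q\ge 1$ let $x_1,\dots,x_Q$ and $w_1,\dots,w_Q$ be the nodes and weights of the $Q$-point Gauss quadrature formula on $[-1,1]$ with weight function $w$ (Gauss–Jacobi quadrature): the $x_j$ are the zeros of the degree-$Q$ orthogonal polynomial for $w$ on $[-1,1]$, and $w_j=\int_{-1}^1 w(x)\ell_j(x)\,dx$ with $\ell_j$ the Lagrange basis polynomials of the nodes. Let \[ \tau_{\mathrm{GJ}}(Q)=\int_{-1}^1 f_0(x)w(x)\,dx-\sum_{j=1}^{Q}w_jf_0(x_j). \] Then, for every $t\in[0,T]$ and every integer $Q\ge 1$, $I_0=\int_{-1}^1 f_0(x)w(x)\,dx$ (so that $\tau_{\mathrm{GJ}}(Q)$ is the Gauss–Jacobi quadrature error for $I_0$),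 and \[ |\tau_{\mathrm{GJ}}(Q)|\le\frac{4L_0^{1-\alpha}}{\Gamma(2-\alpha)}\Big(1+\frac{TL_0}{4Q}\Big)\Big(\frac{eTL_0}{8Q}\Big)^{2Q}. \] -/

import Mathlib

open Polynomial

noncomputable section

namespace GaussJacobi

/-- The weighted inner product `∫_{-1}^1 w(x) p(x) q(x) dx` of two real polynomials. -/
def weightedInner (w : ℝ → ℝ) (p q : ℝ[X]) : ℝ :=
  ∫ x in (-1 : ℝ)..1, w x * (p.eval x * q.eval x)

/-- The monic orthogonal polynomial of degree `n` on `[-1,1]` with respect to the weight `w`,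
obtained from `1, X, X², …` by Gram–Schmidt orthogonalization. -/
def orthoPoly (w : ℝ → ℝ) (n : ℕ) : ℝ[X] :=
  X ^ n - ∑ k : Fin n,
    C (weightedInner w (X ^ n) (orthoPoly w k) /
        weightedInner w (orthoPoly w k) (orthoPoly w k)) * orthoPoly w k
termination_by n
decreasing_by all_goals exact k.isLt

/-- The nodes of the `Q`-point Gauss formula for the weight `w` on `[-1,1]`: the zeros of the
orthogonal polynomial of degree `Q`. -/
def gaussNodes (w : ℝ → ℝ) (Q : ℕ) : Finset ℝ :=
  (orthoPoly w Q).roots.toFinset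

/-- The weight of the `Q`-point Gauss formula at the node `ξ`: the integral against `w` of the
Lagrange basis polynomial of the node `ξ`. -/
def gaussWeight (w : ℝ → ℝ) (Q : ℕ) (ξ : ℝ) : ℝ :=
  ∫ x in (-1 : ℝ)..1, w x * (Lagrange.basis (gaussNodes w Q) id ξ).eval x

/-- The `Q`-point Gauss formula `I_Q f = ∑ⱼ wⱼ f(xⱼ)` for the weight `w` on `[-1,1]`. -/
def gaussQuadrature (w : ℝ → ℝ) (Q : ℕ) (f : ℝ → ℝ) : ℝ :=
  ∑ ξ ∈ gaussNodes w Q, gaussWeight w Q ξ * f ξ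

/-- The Jacobi weight `(1 + x)^{-α}`. -/
def jacobiWeight (α : ℝ) (x : ℝ) : ℝ := (1 + x) ^ (-α)

/-- The transformed integrand
`f₀(x) = (1/Γ(1-α)) (L₀/2)^{1-α} e^{-t(x+1)L₀/2}` on the reference interval `[-1,1]`. -/
def f₀ (α L₀ t : ℝ) (x : ℝ) : ℝ :=
  1 / Real.Gamma (1 - α) * (L₀ / 2) ^ (1 - α) * Real.exp (-t * (x + 1) * L₀ / 2)

/-- The initial integral `I₀ = (1/Γ(1-α)) ∫₀^{L₀} x^{-α} e^{-tx} dx`. -/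
def I₀ (α L₀ t : ℝ) : ℝ :=
  1 / Real.Gamma (1 - α) * ∫ x in (0 : ℝ)..L₀, x ^ (-α) * Real.exp (-t * x)

/-- The Gauss–Jacobi error `τ_GJ(Q) = ∫_{-1}^1 f₀(x) w(x) dx - ∑ⱼ wⱼ f₀(xⱼ)`. -/
def tauGJ (α L₀ t : ℝ) (Q : ℕ) : ℝ :=
  (∫ x in (-1 : ℝ)..1, f₀ α L₀ t x * jacobiWeight α x) -
    gaussQuadrature (jacobiWeight α) Q (f₀ α L₀ t)

end GaussJacobi

end

/-!
Let `π` be the monic orthogonal polynomial of degree `Q` and `H` the Hermite interpolation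
polynomial of `f` at its zeros, of degree less than `2 * Q`. The Gauss formula is exact for `H` and
takes the same value on `f` and `H`, so its error on `f` is `∫ w * (f - H)`. By Rolle's theorem
`f - H` is `π ^ 2` times a value of `f^(2Q) / (2Q)!`, so the error is at most
`max |f^(2Q)| / (2Q)! * ∫ w * π ^ 2`. Among monic polynomials of degree `Q`, `π` minimizes
`∫ w * q ^ 2`; comparison with the Chebyshev polynomial `T_Q / 2 ^ (Q - 1)` gives
`∫ w * π ^ 2 ≤ (∫ w) / 4 ^ (Q - 1)`. For the exponential `f₀` the derivative contributes
`(t * L₀ / 2) ^ (2 * Q)`, and `n ^ n ≤ e ^ n * n!` turns the factorial into a power.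

The zeros of `π` are simple and lie in `(-1, 1)`: if `π = q * r` with `q ≥ 0` on `(-1, 1)`, then
`∫ w * π * r = ∫ w * q * r ^ 2 > 0`, so `π` is not orthogonal to `r`, whence `deg r = Q` and `q` is
constant.
-/

namespace GaussJacobi

open Set MeasureTheory
open scoped Finset Nat

section Rolle

theorem contDiff_eval (p : ℝ[X]) (n : WithTop ℕ∞) : ContDiff ℝ n fun x => p.eval x := by
  simpa only [coe_aeval_eq_eval] using p.contDiff_aeval (𝕜 := ℝ) n

theorem iteratedDeriv_eval (p : ℝ[X]) (n : ℕ) :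
    iteratedDeriv n (fun x => p.eval x) = fun x => (derivative^[n] p).eval x := by
  induction n generalizing p with
  | zero => simp
  | succ n ih =>
    have hderiv : deriv (fun x => p.eval x) = fun x => p.derivative.eval x :=
      funext fun x => p.deriv
    rw [iteratedDeriv_succ', hderiv, ih, Function.iterate_succ_apply]

theorem iteratedDeriv_eval_of_natDegree_le {p : ℝ[X]} {n : ℕ} (hp : p.natDegree ≤ n) (x : ℝ) :
    iteratedDeriv n (fun x => p.eval x) x = n ! * p.coeff n := by
  have hconst : (derivative^[n] p).natDegree = 0 := by
    have := natDegree_iterate_derivative p n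
    omega
  rw [iteratedDeriv_eval, eq_C_of_natDegree_eq_zero hconst]
  simp [coeff_iterate_derivative, Nat.descFactorial_self]

variable {S : Set ℝ} [S.OrdConnected] {f : ℝ → ℝ} {s s' : Finset ℝ}

theorem exists_finset_deriv_eq_zero (hf : ContinuousOn f S) (hsS : ↑s ⊆ S)
    (hs : ∀ x ∈ s, f x = 0) :
    ∃ t : Finset ℝ, ↑t ⊆ S ∧ Disjoint s t ∧ #s ≤ #t + 1 ∧ ∀ x ∈ t, deriv f x = 0 := by
  have hrolle (x y : ℝ) : ∃ c, x ∈ s → y ∈ s → x < y → c ∈ Ioo x y ∧ deriv f c = 0 := by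
    by_cases h : x ∈ s ∧ y ∈ s ∧ x < y
    · obtain ⟨hx, hy, hxy⟩ := h
      obtain ⟨c, hc⟩ := exists_deriv_eq_zero hxy
        (hf.mono (OrdConnected.out ‹_› (hsS hx) (hsS hy))) ((hs x hx).trans (hs y hy).symm)
      exact ⟨c, fun _ _ _ => hc⟩
    · exact ⟨0, fun hx hy hxy => absurd ⟨hx, hy, hxy⟩ h⟩
  choose c hc using hrolle
  let t := {p ∈ s ×ˢ s | p.1 < p.2}.image fun p => c p.1 p.2
  have ht : ∀ z ∈ t, z ∈ S ∧ deriv f z = 0 := by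
    simp only [t, Finset.forall_mem_image, Finset.mem_filter, Finset.mem_product]
    rintro ⟨x, y⟩ ⟨⟨hx, hy⟩, hxy⟩
    obtain ⟨hmem, hzero⟩ := hc x y hx hy hxy
    exact ⟨OrdConnected.out ‹_› (hsS hx) (hsS hy) (Ioo_subset_Icc_self hmem), hzero⟩
  refine ⟨t \ s, fun z hz => (ht z (Finset.mem_sdiff.mp hz).1).1, Finset.disjoint_sdiff,
    Finset.card_le_sdiff_of_interleaved fun x hx y hy hxy _ => ⟨c x y, ?_, (hc x y hx hy hxy).1⟩,
    fun z hz => (ht z (Finset.mem_sdiff.mp hz).1).2⟩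
  exact Finset.mem_image_of_mem (fun p : ℝ × ℝ => c p.1 p.2)
    (Finset.mem_filter.mpr ⟨Finset.mk_mem_product hx hy, hxy⟩)

theorem exists_iteratedDeriv_eq_zero {n : ℕ} (hf : ContDiff ℝ n f) (hsS : ↑s ⊆ S)
    (hs : ∀ x ∈ s, f x = 0) (hn : n < #s) : ∃ c ∈ S, iteratedDeriv n f c = 0 := by
  induction n generalizing f s with
  | zero =>
    obtain ⟨x, hx⟩ := Finset.card_pos.mp hn
    exact ⟨x, hsS hx, by simpa only [iteratedDeriv_zero] using hs x hx⟩
  | succ n ih =>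
    obtain ⟨t, htS, -, hst, ht⟩ := exists_finset_deriv_eq_zero hf.continuous.continuousOn hsS hs
    rw [iteratedDeriv_succ']
    exact ih (contDiff_succ_iff_deriv.mp hf).2.2 htS ht (by omega)

theorem exists_iteratedDeriv_eq_zero_of_double_zeros {n : ℕ} (hf : ContDiff ℝ n f) (hsS : ↑s ⊆ S)
    (hs : ∀ x ∈ s, f x = 0) (hss' : s' ⊆ s) (hs' : ∀ x ∈ s', HasDerivAt f 0 x)
    (hn : n < #s + #s') : ∃ c ∈ S, iteratedDeriv n f c = 0 := by
  cases n with
  | zero =>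
    have := Finset.card_le_card hss'
    exact exists_iteratedDeriv_eq_zero hf hsS hs (by omega)
  | succ n =>
    obtain ⟨t, htS, hdisj, hst, ht⟩ :=
      exists_finset_deriv_eq_zero hf.continuous.continuousOn hsS hs
    have hcard : #(t ∪ s') = #t + #s' :=
      Finset.card_union_of_disjoint (hdisj.mono_left hss').symm
    have hunion : ((t ∪ s' : Finset ℝ) : Set ℝ) ⊆ S := by
      rw [Finset.coe_union]
      exact union_subset htS ((Finset.coe_subset.mpr hss').trans hsS)
    rw [iteratedDeriv_succ']
    exact exists_iteratedDeriv_eq_zero (contDiff_succ_iff_deriv.mp hf).2.2 hunion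
      (fun x hx => (Finset.mem_union.mp hx).elim (ht x) fun h => (hs' x h).deriv) (by omega)

theorem exists_iteratedDeriv_eq_factorial_mul_coeff {n : ℕ} (hf : ContDiff ℝ n f) {p : ℝ[X]}
    (hp : p.natDegree ≤ n) (hsS : ↑s ⊆ S) (hs : ∀ x ∈ s, f x = p.eval x) (hss' : s' ⊆ s)
    (hs' : ∀ x ∈ s', HasDerivAt f (p.derivative.eval x) x) (hn : n < #s + #s') :
    ∃ c ∈ S, iteratedDeriv n f c = n ! * p.coeff n := by
  have hpn : ContDiff ℝ n fun x => p.eval x := contDiff_eval p n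
  obtain ⟨c, hc, h⟩ := exists_iteratedDeriv_eq_zero_of_double_zeros (hf.sub hpn) hsS
    (fun x hx => sub_eq_zero.mpr (hs x hx)) hss'
    (fun x hx => by simpa only [sub_self] using (hs' x hx).fun_sub (p.hasDerivAt x)) hn
  refine ⟨c, hc, ?_⟩
  rwa [iteratedDeriv_fun_sub hf.contDiffAt hpn.contDiffAt,
    iteratedDeriv_eval_of_natDegree_le hp, sub_eq_zero] at h

end Rolle

section Hermite

variable {F : Type*} [Field F] {s : Finset F} {x : F}

theorem eval_nodal_id_of_mem (hx : x ∈ s) : (Lagrange.nodal s id).eval x = 0 :=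
  Lagrange.eval_nodal_at_node (v := id) hx

theorem eval_derivative_nodal_id_ne_zero (hx : x ∈ s) :
    (derivative (Lagrange.nodal s id)).eval x ≠ 0 := by
  classical
  have h := Lagrange.nodalWeight_ne_zero (v := id) Function.injective_id.injOn hx
  rw [Lagrange.nodalWeight_eq_eval_derivative_nodal hx] at h
  exact inv_eq_zero.not.mp h

variable [DecidableEq F]

theorem eval_interpolate_id_of_mem (hx : x ∈ s) (r : F → F) :
    (Lagrange.interpolate s id r).eval x = r x :=
  Lagrange.eval_interpolate_at_node (v := id) r Function.injective_id.injOn hx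

/-- The Hermite interpolation polynomial of degree less than `2 * #s` with value `r x` and
derivative `r' x` at each `x ∈ s`: a multiple of the nodal polynomial corrects the derivatives of
the Lagrange interpolation polynomial without changing its values. -/
noncomputable def hermiteInterpolate (s : Finset F) (r r' : F → F) : F[X] :=
  Lagrange.interpolate s id r + Lagrange.nodal s id *
    Lagrange.interpolate s id fun x =>
      (r' x - (derivative (Lagrange.interpolate s id r)).eval x) /
        (derivative (Lagrange.nodal s id)).eval x

theorem degree_hermiteInterpolate_lt (s : Finset F) (r r' : F → F) :
    (hermiteInterpolate s r r').degree < (2 * #s : ℕ) := by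
  have hinterp (q : F → F) : (Lagrange.interpolate s id q).degree < (#s : ℕ) :=
    Lagrange.degree_interpolate_lt q Function.injective_id.injOn
  have hle : (#s : WithBot ℕ) ≤ (2 * #s : ℕ) := by exact_mod_cast (by omega : #s ≤ 2 * #s)
  refine (degree_add_le _ _).trans_lt (max_lt ((hinterp r).trans_le hle) ?_)
  rw [degree_mul, Lagrange.degree_nodal, two_mul, Nat.cast_add]
  exact WithBot.add_lt_add_left (WithBot.natCast_ne_bot _) (hinterp _)

theorem eval_hermiteInterpolate_of_mem (hx : x ∈ s) (r r' : F → F) :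
    (hermiteInterpolate s r r').eval x = r x := by
  rw [hermiteInterpolate, eval_add, eval_mul, eval_nodal_id_of_mem hx,
    eval_interpolate_id_of_mem hx, zero_mul, add_zero]

theorem eval_derivative_hermiteInterpolate_of_mem (hx : x ∈ s) (r r' : F → F) :
    (derivative (hermiteInterpolate s r r')).eval x = r' x := by
  rw [hermiteInterpolate, derivative_add, derivative_mul, eval_add, eval_add, eval_mul, eval_mul,
    eval_nodal_id_of_mem hx, eval_interpolate_id_of_mem hx,
    mul_div_cancel₀ _ (eval_derivative_nodal_id_ne_zero hx)]
  ring

variable {S : Set ℝ} [S.OrdConnected] {f : ℝ → ℝ} {s : Finset ℝ} {x : ℝ}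

theorem exists_sub_eval_eq_mul_nodal_sq (hf : ContDiff ℝ (2 * #s : ℕ) f) (hsS : ↑s ⊆ S)
    (hx : x ∈ S) {p : ℝ[X]} (hp : p.degree < (2 * #s : ℕ)) (hs : ∀ y ∈ s, f y = p.eval y)
    (hs' : ∀ y ∈ s, HasDerivAt f (p.derivative.eval y) y) :
    ∃ c ∈ S, f x - p.eval x =
      iteratedDeriv (2 * #s) f c / (2 * #s)! * (Lagrange.nodal s id).eval x ^ 2 := by
  by_cases hxs : x ∈ s
  · exact ⟨x, hx, by simp [hs x hxs, eval_nodal_id_of_mem hxs]⟩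
  set N := Lagrange.nodal s (id : ℝ → ℝ) with hN
  have hNx : N.eval x ≠ 0 := Lagrange.eval_nodal_not_at_node fun y hy h => hxs (h ▸ hy)
  have hNdeg : (N ^ 2).natDegree = 2 * #s := by rw [natDegree_pow, Lagrange.natDegree_nodal]
  -- `K` is chosen so that `q` agrees with `f` at `x` as well.
  set K := (f x - p.eval x) / N.eval x ^ 2 with hK
  set q := p + C K * N ^ 2 with hq
  have hqdeg : q.natDegree ≤ 2 * #s :=
    natDegree_add_le_of_degree_le (natDegree_le_of_degree_le hp.le)
      ((natDegree_C_mul_le _ _).trans hNdeg.le)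
  have hqcoeff : q.coeff (2 * #s) = K := by
    rw [hq, coeff_add, coeff_eq_zero_of_degree_lt hp, coeff_C_mul, ← hNdeg,
      (Lagrange.nodal_monic.pow 2).coeff_natDegree, zero_add, mul_one]
  have hqx : f x = q.eval x := by
    simp only [hq, hK, eval_add, eval_mul, eval_C, eval_pow]
    field_simp
    ring
  have hqs (y : ℝ) (hy : y ∈ s) : f y = q.eval y := by
    simp [hq, hN, hs y hy, eval_nodal_id_of_mem hy]
  have hqs' (y : ℝ) (hy : y ∈ s) : HasDerivAt f (q.derivative.eval y) y := by
    simpa [hq, hN, derivative_pow, eval_nodal_id_of_mem hy] using hs' y hy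
  obtain ⟨c, hc, h⟩ := exists_iteratedDeriv_eq_factorial_mul_coeff (S := S) hf hqdeg
    (s := insert x s) (by rw [Finset.coe_insert]; exact insert_subset hx hsS)
    ((Finset.forall_mem_insert _ _ _).mpr ⟨hqx, hqs⟩) (Finset.subset_insert x s) hqs'
    (by rw [Finset.card_insert_of_notMem hxs]; omega)
  refine ⟨c, hc, ?_⟩
  rw [h, hqcoeff, hK, mul_div_cancel_left₀ _ (by positivity), div_mul_cancel₀ _ (by positivity)]

theorem exists_sub_eval_hermiteInterpolate_eq (hf : ContDiff ℝ (2 * #s : ℕ) f) (hsS : ↑s ⊆ S)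
    (hx : x ∈ S) :
    ∃ c ∈ S, f x - (hermiteInterpolate s f (deriv f)).eval x =
      iteratedDeriv (2 * #s) f c / (2 * #s)! * (Lagrange.nodal s id).eval x ^ 2 := by
  refine exists_sub_eval_eq_mul_nodal_sq hf hsS hx (degree_hermiteInterpolate_lt s f (deriv f))
    (fun y hy => (eval_hermiteInterpolate_of_mem hy f (deriv f)).symm) fun y hy => ?_
  have hcard : #s ≠ 0 := Finset.card_ne_zero_of_mem hy
  rw [eval_derivative_hermiteInterpolate_of_mem hy]
  exact (hf.differentiable (by simpa using hcard) y).hasDerivAt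

end Hermite

section NonnegFactors

variable {a b : ℝ} {p : ℝ[X]}

theorem nonneg_or_neg_nonneg_of_eval_ne_zero (hp : ∀ x ∈ Ioo a b, p.eval x ≠ 0) :
    (∀ x ∈ Ioo a b, 0 ≤ p.eval x) ∨ ∀ x ∈ Ioo a b, 0 ≤ (-p).eval x := by
  simp only [eval_neg, neg_nonneg]
  by_contra! ⟨⟨x, hx, hx0⟩, y, hy, hy0⟩
  obtain ⟨c, hc, hc0⟩ := isPreconnected_Ioo.intermediate_value hx hy p.continuous.continuousOn
    ⟨hx0.le, hy0.le⟩
  exact hp c hc hc0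

/-- The only divisors of `p` that are nonnegative on the open interval `(a, b)` are constants.
Equivalently, `p` is nonzero, all its complex zeros are simple, and they lie in `(a, b)`: this is
how the zeros of orthogonal polynomials are located. -/
def HasNoNonnegFactor (p : ℝ[X]) (a b : ℝ) : Prop :=
  ∀ q, q ∣ p → (∀ x ∈ Ioo a b, 0 ≤ q.eval x) → IsUnit q

namespace HasNoNonnegFactor

variable (hp : HasNoNonnegFactor p a b)
include hp

theorem isUnit_of_dvd_of_eval_ne_zero {q : ℝ[X]} (hqp : q ∣ p)
    (hq : ∀ x ∈ Ioo a b, q.eval x ≠ 0) : IsUnit q :=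
  (nonneg_or_neg_nonneg_of_eval_ne_zero hq).elim (hp q hqp) fun h =>
    (IsUnit.neg_iff q).mp (hp (-q) (neg_dvd.mpr hqp) h)

theorem mem_Ioo_of_mem_roots {r : ℝ} (hr : r ∈ p.roots) : r ∈ Ioo a b := by
  by_contra hrab
  refine not_isUnit_X_sub_C r (hp.isUnit_of_dvd_of_eval_ne_zero
    (dvd_iff_isRoot.mpr (isRoot_of_mem_roots hr)) fun x hx h => hrab ?_)
  rw [eval_sub, eval_X, eval_C, sub_eq_zero] at h
  exact h ▸ hx

theorem not_X_sub_C_sq_dvd (r : ℝ) : ¬(X - C r) ^ 2 ∣ p := by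
  intro hdvd
  have hsq : IsUnit ((X - C r) ^ 2) := hp _ hdvd fun x _ => by
    rw [eval_pow]
    exact sq_nonneg _
  exact not_isUnit_X_sub_C r ((isUnit_pow_iff two_ne_zero).mp hsq)

theorem ne_zero : p ≠ 0 := fun h => hp.not_X_sub_C_sq_dvd 0 (h ▸ dvd_zero _)

theorem nodup_roots : p.roots.Nodup := by
  refine Multiset.nodup_iff_count_le_one.mpr fun r => ?_
  rw [count_roots]
  by_contra! hmult
  exact hp.not_X_sub_C_sq_dvd r ((pow_dvd_pow _ hmult).trans (pow_rootMultiplicity_dvd p r))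

theorem splits : p.Splits := by
  obtain ⟨q, hpq, -, hq⟩ := exists_prod_multiset_X_sub_C_mul p
  have hq0 : q ≠ 0 := by
    rintro rfl
    exact hp.ne_zero (by rw [← hpq, mul_zero])
  have hqunit : IsUnit q := hp.isUnit_of_dvd_of_eval_ne_zero (Dvd.intro_left _ hpq)
    fun x _ hx => by simpa [hq] using (mem_roots hq0).mpr hx
  have hprod : ((p.roots.map fun r => X - C r).prod).Splits := by
    refine .multisetProd fun f hf => ?_
    obtain ⟨r, -, rfl⟩ := Multiset.mem_map.mp hf
    exact .X_sub_C r
  exact hpq ▸ hprod.mul hqunit.splits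

end HasNoNonnegFactor

end NonnegFactors

section OrthogonalPolynomials

theorem degree_sum_C_mul_lt {R : Type*} [Semiring R] {n : ℕ} {p : ℕ → R[X]}
    (hp : ∀ k < n, (p k).degree = k) (c : Fin n → R) :
    (∑ k : Fin n, C (c k) * p k).degree < n :=
  (degree_sum_le _ _).trans_lt <| (Finset.sup_lt_iff (WithBot.bot_lt_coe n)).mpr fun k _ =>
    ((smul_eq_C_mul (c k) ▸ degree_smul_le (c k) (p k)).trans_eq (hp k k.isLt)).trans_lt
      (Nat.cast_lt.mpr k.isLt)

theorem degree_orthoPoly (w : ℝ → ℝ) (n : ℕ) : (orthoPoly w n).degree = n := by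
  induction n using Nat.strong_induction_on with
  | _ n ih =>
    rw [orthoPoly, degree_sub_eq_left_of_degree_lt, degree_X_pow]
    rw [degree_X_pow]
    exact degree_sum_C_mul_lt ih _

theorem natDegree_orthoPoly (w : ℝ → ℝ) (n : ℕ) : (orthoPoly w n).natDegree = n :=
  natDegree_eq_of_degree_eq_some (degree_orthoPoly w n)

theorem orthoPoly_monic (w : ℝ → ℝ) (n : ℕ) : (orthoPoly w n).Monic := by
  rw [orthoPoly]
  exact monic_X_pow_sub (degree_sum_C_mul_lt (fun k _ => degree_orthoPoly w k) _)

/-- The polynomials `orthoPoly w n` as a sequence with one polynomial in each degree. -/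
noncomputable def orthoPolySequence (w : ℝ → ℝ) : Polynomial.Sequence ℝ where
  elems' := orthoPoly w
  degree_eq' := degree_orthoPoly w

variable {w : ℝ → ℝ} (hw : IntervalIntegrable w volume (-1) 1)

/-- The linear functional `p ↦ ∫_{-1}^1 w(x) p(x) dx` on polynomials. -/
noncomputable def weightedIntegral : ℝ[X] →ₗ[ℝ] ℝ where
  toFun p := ∫ x in (-1 : ℝ)..1, w x * p.eval x
  map_add' p q := by
    simp_rw [eval_add, mul_add]
    exact intervalIntegral.integral_add (hw.mul_continuousOn p.continuous.continuousOn)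
      (hw.mul_continuousOn q.continuous.continuousOn)
  map_smul' c p := by
    simp_rw [eval_smul, smul_eq_mul, mul_left_comm _ c, RingHom.id_apply]
    exact intervalIntegral.integral_const_mul c _

theorem weightedIntegral_apply (p : ℝ[X]) :
    weightedIntegral hw p = ∫ x in (-1 : ℝ)..1, w x * p.eval x :=
  rfl

theorem weightedInner_eq (p q : ℝ[X]) : weightedInner w p q = weightedIntegral hw (p * q) := by
  simp only [weightedInner, weightedIntegral_apply, eval_mul]

variable (hpos : ∀ x ∈ Ioo (-1 : ℝ) 1, 0 < w x)
include hpos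

theorem weightedIntegral_pos {p : ℝ[X]} (hp0 : p ≠ 0)
    (hp : ∀ x ∈ Ioo (-1 : ℝ) 1, 0 ≤ p.eval x) : 0 < weightedIntegral hw p := by
  have hnonneg : 0 ≤ᵐ[volume.restrict (uIoc (-1) 1)] fun x => w x * p.eval x := by
    rw [uIoc_of_le (by norm_num)]
    refine ae_restrict_of_ae_eq_of_ae_restrict Ioo_ae_eq_Ioc ?_
    exact ae_restrict_of_forall_mem measurableSet_Ioo fun x hx =>
      mul_nonneg (hpos x hx).le (hp x hx)
  have hsupport : Ioo (-1 : ℝ) 1 \ p.roots.toFinset ⊆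
      Function.support (fun x => w x * p.eval x) ∩ Ioc (-1 : ℝ) 1 := by
    rintro x ⟨hx, hroot⟩
    refine ⟨mul_ne_zero (hpos x hx).ne' fun h => hroot ?_, Ioo_subset_Ioc_self hx⟩
    simpa [hp0] using h
  have hmeas : 0 < volume (Ioo (-1 : ℝ) 1 \ p.roots.toFinset) := by
    rw [measure_sdiff_null (Finset.measure_zero _ _), Real.volume_Ioo]
    norm_num
  exact (intervalIntegral.integral_pos_iff_support_of_nonneg_ae' hnonneg
    (hw.mul_continuousOn p.continuous.continuousOn)).mpr
    ⟨by norm_num, hmeas.trans_le (measure_mono hsupport)⟩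

theorem weightedIntegral_mul_self_pos {p : ℝ[X]} (hp : p ≠ 0) :
    0 < weightedIntegral hw (p * p) :=
  weightedIntegral_pos hw hpos (mul_ne_zero hp hp) fun x _ => by
    rw [eval_mul]
    exact mul_self_nonneg _

theorem weightedIntegral_mul_self_nonneg (p : ℝ[X]) : 0 ≤ weightedIntegral hw (p * p) := by
  rcases eq_or_ne p 0 with rfl | hp
  · rw [zero_mul, map_zero]
  · exact (weightedIntegral_mul_self_pos hw hpos hp).le

theorem weightedIntegral_orthoPoly_mul_orthoPoly {m n : ℕ} (h : m < n) :
    weightedIntegral hw (orthoPoly w n * orthoPoly w m) = 0 := by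
  induction n using Nat.strong_induction_on generalizing m with
  | _ n ih =>
    have hne := (weightedIntegral_mul_self_pos hw hpos (orthoPoly_monic w m).ne_zero).ne'
    rw [orthoPoly, sub_mul, map_sub, Finset.sum_mul, map_sum,
      Finset.sum_eq_single (⟨m, h⟩ : Fin n)]
    · rw [mul_assoc, ← smul_eq_C_mul, map_smul, weightedInner_eq hw, weightedInner_eq hw,
        smul_eq_mul, div_mul_cancel₀ _ hne, sub_self]
    · intro k _ hk
      rw [mul_assoc, ← smul_eq_C_mul, map_smul]
      rcases (Fin.val_ne_iff.mpr hk).lt_or_gt with hlt | hlt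
      · rw [mul_comm (orthoPoly w k), ih m h hlt, smul_zero]
      · rw [ih k k.isLt hlt, smul_zero]
    · simp

theorem weightedIntegral_orthoPoly_mul_eq_zero {n : ℕ} {p : ℝ[X]} (hp : p.degree < n) :
    weightedIntegral hw (orthoPoly w n * p) = 0 := by
  have hker : degreeLT ℝ n ≤
      LinearMap.ker (weightedIntegral hw ∘ₗ LinearMap.mulLeft ℝ (orthoPoly w n)) := by
    rw [← (orthoPolySequence w).span_degreeLT fun k _ =>
      (orthoPoly_monic w k).leadingCoeff ▸ isUnit_one, Submodule.span_le]
    rintro _ ⟨m, hm, rfl⟩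
    exact weightedIntegral_orthoPoly_mul_orthoPoly hw hpos hm
  exact hker (mem_degreeLT.mpr hp)

include hw in
theorem hasNoNonnegFactor_orthoPoly (n : ℕ) : HasNoNonnegFactor (orthoPoly w n) (-1) 1 := by
  rintro q ⟨r, hqr⟩ hq
  have hq0 : q ≠ 0 := left_ne_zero_of_mul (hqr ▸ (orthoPoly_monic w n).ne_zero)
  have hr0 : r ≠ 0 := right_ne_zero_of_mul (hqr ▸ (orthoPoly_monic w n).ne_zero)
  have hdeg : q.natDegree + r.natDegree = n := by
    rw [← natDegree_mul hq0 hr0, ← hqr, natDegree_orthoPoly]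
  rw [isUnit_iff_degree_eq_zero, degree_eq_natDegree hq0, Nat.cast_eq_zero]
  by_contra hqdeg
  have hzero : weightedIntegral hw (orthoPoly w n * r) = 0 :=
    weightedIntegral_orthoPoly_mul_eq_zero hw hpos ((natDegree_lt_iff_degree_lt hr0).mp (by omega))
  have hpos' : 0 < weightedIntegral hw (orthoPoly w n * r) := by
    refine weightedIntegral_pos hw hpos (mul_ne_zero (orthoPoly_monic w n).ne_zero hr0) ?_
    intro x hx
    rw [hqr, mul_assoc, eval_mul, eval_mul]
    exact mul_nonneg (hq x hx) (mul_self_nonneg _)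
  exact hpos'.ne' hzero

include hw in
theorem weightedInner_orthoPoly_self_le {n : ℕ} {q : ℝ[X]} (hq : q.Monic)
    (hdeg : q.natDegree = n) :
    weightedInner w (orthoPoly w n) (orthoPoly w n) ≤ weightedInner w q q := by
  set p := orthoPoly w n
  have hpmonic : p.Monic := orthoPoly_monic w n
  have hqdeg : q.degree = n := hdeg ▸ degree_eq_natDegree hq.ne_zero
  have hrdeg : (q - p).degree < n :=
    hqdeg ▸ degree_sub_lt_left (hqdeg.trans (degree_orthoPoly w n).symm) hq.ne_zero
      (hq.leadingCoeff.trans hpmonic.leadingCoeff.symm)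
  have horth : weightedIntegral hw (p * (q - p)) = 0 :=
    weightedIntegral_orthoPoly_mul_eq_zero hw hpos hrdeg
  have hpythagoras : weightedIntegral hw (q * q) =
      weightedIntegral hw (p * p) + weightedIntegral hw ((q - p) * (q - p)) := by
    rw [show q * q = p * p + (q - p) * (q - p) + (2 : ℝ) • (p * (q - p)) by
      rw [smul_eq_C_mul, C_ofNat]; ring, map_add, map_add, map_smul, horth, smul_zero, add_zero]
  rw [weightedInner_eq hw, weightedInner_eq hw, hpythagoras]
  exact le_add_of_nonneg_right (weightedIntegral_mul_self_nonneg hw hpos _)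

end OrthogonalPolynomials

section GaussQuadrature

theorem gaussQuadrature_congr {w f g : ℝ → ℝ} {Q : ℕ} (h : ∀ x ∈ gaussNodes w Q, f x = g x) :
    gaussQuadrature w Q f = gaussQuadrature w Q g :=
  Finset.sum_congr rfl fun x hx => by rw [h x hx]

variable {w : ℝ → ℝ} (hw : IntervalIntegrable w volume (-1) 1)
  (hpos : ∀ x ∈ Ioo (-1 : ℝ) 1, 0 < w x) (Q : ℕ)
include hw hpos

theorem gaussNodes_subset_Ioo : ↑(gaussNodes w Q) ⊆ Ioo (-1 : ℝ) 1 := fun _ hx =>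
  (hasNoNonnegFactor_orthoPoly hw hpos Q).mem_Ioo_of_mem_roots (Multiset.mem_toFinset.mp hx)

theorem nodal_gaussNodes : Lagrange.nodal (gaussNodes w Q) id = orthoPoly w Q := by
  have hfactor := hasNoNonnegFactor_orthoPoly hw hpos Q
  rw [hfactor.splits.eq_prod_roots_of_monic (orthoPoly_monic w Q), Lagrange.nodal, Finset.prod,
    gaussNodes, Multiset.toFinset_val, hfactor.nodup_roots.dedup]
  rfl

theorem card_gaussNodes : #(gaussNodes w Q) = Q := by
  rw [← Lagrange.natDegree_nodal (v := id), nodal_gaussNodes hw hpos, natDegree_orthoPoly]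

theorem gaussQuadrature_eval_of_degree_lt {p : ℝ[X]} (hp : p.degree < Q) :
    gaussQuadrature w Q (fun x => p.eval x) = weightedIntegral hw p := by
  have hinterp : p = ∑ x ∈ gaussNodes w Q, C (p.eval x) * Lagrange.basis (gaussNodes w Q) id x :=
    (Lagrange.eq_interpolate Function.injective_id.injOn
      (by rwa [card_gaussNodes hw hpos])).trans (Lagrange.interpolate_apply _ _ _)
  conv_rhs => rw [hinterp]
  rw [map_sum, gaussQuadrature]
  refine Finset.sum_congr rfl fun x _ => ?_
  rw [← smul_eq_C_mul, map_smul, smul_eq_mul, mul_comm]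
  rfl

theorem gaussQuadrature_eval_of_degree_lt_two_mul {p : ℝ[X]} (hp : p.degree < (2 * Q : ℕ)) :
    gaussQuadrature w Q (fun x => p.eval x) = weightedIntegral hw p := by
  have hmonic := orthoPoly_monic w Q
  set q := p /ₘ orthoPoly w Q with hq
  set r := p %ₘ orthoPoly w Q
  have hdiv : p = r + orthoPoly w Q * q := (modByMonic_add_div p (orthoPoly w Q)).symm
  have hrdeg : r.degree < Q := degree_orthoPoly w Q ▸ degree_modByMonic_lt p hmonic
  have hqdeg : q.degree < Q := by
    rcases eq_or_ne q 0 with h0 | h0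
    · rw [h0, degree_zero]
      exact WithBot.bot_lt_coe Q
    have hp0 : p ≠ 0 := by
      rintro rfl
      exact h0 (zero_divByMonic _)
    have hpdeg := (natDegree_lt_iff_degree_lt hp0).mpr hp
    rw [← natDegree_lt_iff_degree_lt h0, hq, natDegree_divByMonic p hmonic, natDegree_orthoPoly]
    omega
  have hnodes : ∀ x ∈ gaussNodes w Q, p.eval x = r.eval x := by
    intro x hx
    have hroot : (orthoPoly w Q).eval x = 0 := isRoot_of_mem_roots (Multiset.mem_toFinset.mp hx)
    rw [hdiv, eval_add, eval_mul, hroot, zero_mul, add_zero]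
  rw [gaussQuadrature_congr hnodes, gaussQuadrature_eval_of_degree_lt hw hpos Q hrdeg, hdiv,
    map_add, weightedIntegral_orthoPoly_mul_eq_zero hw hpos hqdeg, add_zero]

theorem abs_integral_sub_gaussQuadrature_le {f : ℝ → ℝ} (hf : ContDiff ℝ (2 * Q : ℕ) f) {M : ℝ}
    (hM : ∀ x ∈ Ioo (-1 : ℝ) 1, |iteratedDeriv (2 * Q) f x| ≤ M) :
    |(∫ x in (-1 : ℝ)..1, w x * f x) - gaussQuadrature w Q f| ≤
      M / (2 * Q)! * weightedInner w (orthoPoly w Q) (orthoPoly w Q) := by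
  have hcard := card_gaussNodes hw hpos Q
  set H := hermiteInterpolate (gaussNodes w Q) f (deriv f)
  have hHdeg : H.degree < (2 * Q : ℕ) := by
    simpa only [hcard] using degree_hermiteInterpolate_lt (gaussNodes w Q) f (deriv f)
  have hquad : gaussQuadrature w Q f = ∫ x in (-1 : ℝ)..1, w x * H.eval x := by
    rw [gaussQuadrature_congr fun x hx => (eval_hermiteInterpolate_of_mem hx f (deriv f)).symm]
    exact gaussQuadrature_eval_of_degree_lt_two_mul hw hpos Q hHdeg
  have herror : ∀ x ∈ Ioo (-1 : ℝ) 1,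
      |f x - H.eval x| ≤ M / (2 * Q)! * ((orthoPoly w Q).eval x * (orthoPoly w Q).eval x) := by
    intro x hx
    obtain ⟨c, hc, h⟩ := exists_sub_eval_hermiteInterpolate_eq (hcard.symm ▸ hf)
      (gaussNodes_subset_Ioo hw hpos Q) hx
    rw [h, hcard, nodal_gaussNodes hw hpos, abs_mul, abs_div, Nat.abs_cast, abs_sq, pow_two]
    gcongr
    · exact mul_self_nonneg _
    · exact hM c hc
  have hintH := hw.mul_continuousOn H.continuous.continuousOn
  have hintf := hw.mul_continuousOn hf.continuous.continuousOn
  rw [hquad, ← intervalIntegral.integral_sub hintf hintH, weightedInner,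
    ← intervalIntegral.integral_const_mul]
  refine (intervalIntegral.abs_integral_le_integral_abs (by norm_num)).trans
    (intervalIntegral.integral_mono_on_of_le_Ioo (by norm_num) (hintf.sub hintH).abs
      ((hw.mul_continuousOn ((orthoPoly w Q).continuous.mul
        (orthoPoly w Q).continuous).continuousOn).const_mul _) fun x hx => ?_)
  rw [← mul_sub, abs_mul, abs_of_pos (hpos x hx), mul_left_comm]
  exact mul_le_mul_of_nonneg_left (herror x hx) (hpos x hx).le

theorem weightedInner_orthoPoly_self_le_integral_div (n : ℕ) :
    weightedInner w (orthoPoly w n) (orthoPoly w n) ≤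
      (∫ x in (-1 : ℝ)..1, w x) / 4 ^ (n - 1) := by
  set T := Chebyshev.T ℝ n
  set q := C ((2 : ℝ) ^ (n - 1))⁻¹ * T with hq
  have hTlead : T.leadingCoeff = 2 ^ (n - 1) := by simp [T, Chebyshev.leadingCoeff_T]
  have hqmonic : q.Monic := monic_C_mul_of_mul_leadingCoeff_eq_one <| by
    rw [hTlead, inv_mul_cancel₀ (by positivity)]
  have hqdeg : q.natDegree = n := by
    rw [hq, natDegree_C_mul (by positivity), Chebyshev.natDegree_T, Int.natAbs_natCast]
  refine (weightedInner_orthoPoly_self_le hw hpos hqmonic hqdeg).trans ?_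
  have hqsq : ∀ x ∈ Ioo (-1 : ℝ) 1, q.eval x * q.eval x ≤ 1 / 4 ^ (n - 1) := by
    intro x hx
    have hT : T.eval x ^ 2 ≤ 1 := (sq_le_one_iff_abs_le_one _).mpr
      (Chebyshev.abs_eval_T_real_le_one n (abs_le.mpr ⟨hx.1.le, hx.2.le⟩))
    calc q.eval x * q.eval x = T.eval x ^ 2 / (2 ^ 2) ^ (n - 1) := by
          rw [hq, eval_mul, eval_C, pow_right_comm]
          field_simp
      _ ≤ 1 / 4 ^ (n - 1) := by
          rw [show (2 : ℝ) ^ 2 = 4 by norm_num]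
          gcongr
  rw [div_eq_mul_one_div, ← intervalIntegral.integral_mul_const]
  refine intervalIntegral.integral_mono_on_of_le_Ioo (by norm_num)
    (hw.mul_continuousOn (q.continuous.mul q.continuous).continuousOn) (hw.mul_const _)
    fun x hx => mul_le_mul_of_nonneg_left (hqsq x hx) (hpos x hx).le

end GaussQuadrature

section Jacobi

variable {α L₀ t : ℝ}

theorem intervalIntegrable_jacobiWeight (hα : α < 1) :
    IntervalIntegrable (jacobiWeight α) volume (-1) 1 := by
  have h := (intervalIntegral.intervalIntegrable_rpow' (a := 0) (b := 2)
    (by linarith : -1 < -α)).comp_add_left (c := 1)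
  rwa [show (0 - 1 : ℝ) = -1 by norm_num, show (2 - 1 : ℝ) = 1 by norm_num] at h

theorem jacobiWeight_pos (α : ℝ) {x : ℝ} (hx : -1 < x) : 0 < jacobiWeight α x :=
  Real.rpow_pos_of_pos (by linarith) _

theorem integral_jacobiWeight (hα : α < 1) :
    ∫ x in (-1 : ℝ)..1, jacobiWeight α x = 2 ^ (1 - α) / (1 - α) := by
  simp only [jacobiWeight]
  rw [intervalIntegral.integral_comp_add_left (fun x => x ^ (-α)),
    integral_rpow (Or.inl (by linarith)), neg_add_eq_sub, add_neg_cancel,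
    Real.zero_rpow (by linarith), sub_zero, one_add_one_eq_two]

theorem I₀_eq_integral (α t : ℝ) (hL₀ : 0 < L₀) :
    I₀ α L₀ t = ∫ x in (-1 : ℝ)..1, f₀ α L₀ t x * jacobiWeight α x := by
  have hc : 0 < L₀ / 2 := by positivity
  have hsubst := intervalIntegral.integral_comp_mul_add (a := -1) (b := 1)
    (fun x : ℝ => x ^ (-α) * Real.exp (-t * x)) hc.ne' (L₀ / 2)
  rw [show L₀ / 2 * -1 + L₀ / 2 = 0 by ring, show L₀ / 2 * 1 + L₀ / 2 = L₀ by ring, smul_eq_mul,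
    eq_inv_mul_iff_mul_eq₀ hc.ne'] at hsubst
  rw [I₀, ← hsubst, ← mul_assoc, ← intervalIntegral.integral_const_mul]
  refine intervalIntegral.integral_congr fun x hx => ?_
  rw [uIcc_of_le (by norm_num)] at hx
  simp only [f₀, jacobiWeight]
  rw [show L₀ / 2 * x + L₀ / 2 = L₀ / 2 * (1 + x) by ring,
    Real.mul_rpow hc.le (by linarith [hx.1]), sub_eq_add_neg 1 α, Real.rpow_add hc, Real.rpow_one,
    show -t * (L₀ / 2 * (1 + x)) = -t * (x + 1) * L₀ / 2 by ring]
  ring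

theorem f₀_eq_mul_exp (α L₀ t : ℝ) :
    f₀ α L₀ t = fun x => f₀ α L₀ t 0 * Real.exp (-(t * L₀ / 2) * x) := by
  ext x
  rw [f₀, f₀, mul_assoc _ (Real.exp _), ← Real.exp_add]
  ring_nf

theorem contDiff_f₀ (α L₀ t : ℝ) (n : WithTop ℕ∞) : ContDiff ℝ n (f₀ α L₀ t) := by
  rw [f₀_eq_mul_exp]
  fun_prop

theorem iteratedDeriv_f₀ (α L₀ t : ℝ) (n : ℕ) :
    iteratedDeriv n (f₀ α L₀ t) = fun x => (-(t * L₀ / 2)) ^ n * f₀ α L₀ t x := by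
  ext x
  rw [congrFun (f₀_eq_mul_exp α L₀ t) x]
  conv_lhs => rw [f₀_eq_mul_exp, iteratedDeriv_const_mul_field, iteratedDeriv_exp_const_mul]
  exact mul_left_comm _ _ _

theorem abs_f₀_le (hα : α < 1) (hL₀ : 0 < L₀) (ht : 0 ≤ t) {x : ℝ} (hx : -1 ≤ x) :
    |f₀ α L₀ t x| ≤ 1 / Real.Gamma (1 - α) * (L₀ / 2) ^ (1 - α) := by
  have : 0 < Real.Gamma (1 - α) := Real.Gamma_pos_of_pos (by linarith)
  rw [f₀, abs_of_pos (by positivity)]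
  refine mul_le_of_le_one_right (by positivity) (Real.exp_le_one_iff.mpr ?_)
  have : 0 ≤ t * (x + 1) * L₀ := mul_nonneg (mul_nonneg ht (by linarith)) hL₀.le
  linarith

theorem abs_iteratedDeriv_f₀_le (hα : α < 1) (hL₀ : 0 < L₀) (ht : 0 ≤ t) (n : ℕ) {x : ℝ}
    (hx : -1 ≤ x) : |iteratedDeriv n (f₀ α L₀ t) x| ≤
      (t * L₀ / 2) ^ n * (1 / Real.Gamma (1 - α) * (L₀ / 2) ^ (1 - α)) := by
  have hrate : 0 ≤ t * L₀ / 2 := by positivity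
  rw [iteratedDeriv_f₀, abs_mul, abs_pow, abs_neg, abs_of_nonneg hrate]
  exact mul_le_mul_of_nonneg_left (abs_f₀_le hα hL₀ ht hx) (by positivity)

theorem abs_tauGJ_le (hα : α < 1) (hL₀ : 0 < L₀) (ht : 0 ≤ t) {Q : ℕ} (hQ : Q ≠ 0) :
    |tauGJ α L₀ t Q| ≤ 4 * L₀ ^ (1 - α) / Real.Gamma (2 - α) *
      ((t * L₀ / 4) ^ (2 * Q) / (2 * Q)!) := by
  have hw := intervalIntegrable_jacobiWeight hα
  have hpos (x : ℝ) (hx : x ∈ Ioo (-1 : ℝ) 1) : 0 < jacobiWeight α x := jacobiWeight_pos α hx.1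
  have hα' : 0 < 1 - α := by linarith
  have : 0 < Real.Gamma (1 - α) := Real.Gamma_pos_of_pos hα'
  have herror := abs_integral_sub_gaussQuadrature_le hw hpos Q (contDiff_f₀ α L₀ t _)
    fun x hx => abs_iteratedDeriv_f₀_le hα hL₀ ht (2 * Q) hx.1.le
  simp only [mul_comm (jacobiWeight α _)] at herror
  have hnorm := weightedInner_orthoPoly_self_le_integral_div hw hpos Q
  rw [integral_jacobiWeight hα] at hnorm
  refine herror.trans ((mul_le_mul_of_nonneg_left hnorm (by positivity)).trans_eq ?_)
  have hfour : (4 : ℝ) ^ (2 * Q) = 2 ^ (2 * Q) * (4 * 4 ^ (Q - 1)) := by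
    rw [mul_pow_sub_one hQ, pow_mul 2, ← mul_pow, pow_mul]
    norm_num
  rw [show 2 - α = (1 - α) + 1 by ring, Real.Gamma_add_one hα'.ne',
    Real.div_rpow hL₀.le zero_le_two, div_pow, div_pow, hfour]
  field_simp

theorem pow_div_factorial_le {s : ℝ} (hs : 0 ≤ s) (n : ℕ) :
    s ^ n / n ! ≤ (Real.exp 1 * s / n) ^ n := by
  have hexp : (n : ℝ) ^ n / n ! ≤ Real.exp 1 ^ n := by
    rw [← Real.exp_nat_mul, mul_one]
    exact Real.pow_div_factorial_le_exp n n.cast_nonneg n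
  have hn : 0 < (n : ℝ) ^ n := by
    rcases n.eq_zero_or_pos with rfl | hn <;> positivity
  calc s ^ n / n ! = (n : ℝ) ^ n / n ! * s ^ n / n ^ n := by field_simp
    _ ≤ Real.exp 1 ^ n * s ^ n / n ^ n := by gcongr
    _ = (Real.exp 1 * s / n) ^ n := by rw [div_pow, mul_pow]

theorem abs_tauGJ_le_exp_mul_div_pow (hα : α < 1) (hL₀ : 0 < L₀) (ht : 0 ≤ t) {Q : ℕ}
    (hQ : Q ≠ 0) :
    |tauGJ α L₀ t Q| ≤ 4 * L₀ ^ (1 - α) / Real.Gamma (2 - α) *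
      (Real.exp 1 * t * L₀ / (8 * Q)) ^ (2 * Q) := by
  have : 0 < Real.Gamma (2 - α) := Real.Gamma_pos_of_pos (by linarith)
  calc |tauGJ α L₀ t Q|
      ≤ 4 * L₀ ^ (1 - α) / Real.Gamma (2 - α) * ((t * L₀ / 4) ^ (2 * Q) / (2 * Q)!) :=
        abs_tauGJ_le hα hL₀ ht hQ
    _ ≤ 4 * L₀ ^ (1 - α) / Real.Gamma (2 - α) *
          (Real.exp 1 * (t * L₀ / 4) / (2 * Q : ℕ)) ^ (2 * Q) := by
        gcongr
        exact pow_div_factorial_le (by positivity) _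
    _ = 4 * L₀ ^ (1 - α) / Real.Gamma (2 - α) *
          (Real.exp 1 * t * L₀ / (8 * Q)) ^ (2 * Q) := by
        congr 2
        push_cast
        ring

end Jacobi

end GaussJacobi

theorem mainTheorem6_general {α L₀ T t : ℝ} {Q : ℕ} (hα : α < 1) (hL₀ : 0 < L₀)
    (ht : t ∈ Set.Icc (0 : ℝ) T) (hQ : 1 ≤ Q) :
    GaussJacobi.I₀ α L₀ t =
        ∫ x in (-1 : ℝ)..1, GaussJacobi.f₀ α L₀ t x * GaussJacobi.jacobiWeight α x ∧
    |GaussJacobi.tauGJ α L₀ t Q| ≤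
      4 * L₀ ^ (1 - α) / Real.Gamma (2 - α) * (1 + T * L₀ / (4 * (Q : ℝ))) *
        (Real.exp 1 * T * L₀ / (8 * (Q : ℝ))) ^ (2 * Q) := by
  obtain ⟨ht0, htT⟩ := ht
  have hT : 0 ≤ T := ht0.trans htT
  have : 0 < Real.Gamma (2 - α) := Real.Gamma_pos_of_pos (by linarith)
  have hfactor : 1 ≤ 1 + T * L₀ / (4 * (Q : ℝ)) := le_add_of_nonneg_right (by positivity)
  refine ⟨GaussJacobi.I₀_eq_integral α t hL₀,
    (GaussJacobi.abs_tauGJ_le_exp_mul_div_pow hα hL₀ ht0 (Nat.one_le_iff_ne_zero.mp hQ)).trans ?_⟩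
  gcongr
  exact le_mul_of_one_le_right (by positivity) hfactor

/-- The integral on the reference interval is `I₀`, and the Gauss–Jacobi error obeys the bound. -/
theorem mainTheorem6 (α L₀ T t : ℝ) (Q : ℕ)
    (hα : α ∈ Set.Ioo (0 : ℝ) 1) (hL₀ : 0 < L₀) (hT : 0 < T)
    (ht : t ∈ Set.Icc (0 : ℝ) T) (hQ : 1 ≤ Q) :
    GaussJacobi.I₀ α L₀ t =
        ∫ x in (-1 : ℝ)..1, GaussJacobi.f₀ α L₀ t x * GaussJacobi.jacobiWeight α x ∧
    |GaussJacobi.tauGJ α L₀ t Q| ≤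
      4 * L₀ ^ (1 - α) / Real.Gamma (2 - α) * (1 + T * L₀ / (4 * (Q : ℝ))) *
        (Real.exp 1 * T * L₀ / (8 * (Q : ℝ))) ^ (2 * Q) :=
  mainTheorem6_general hα.2 hL₀ ht hQ
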